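/- There is a universal constant $c>0$ such that the following holds. Let $n$ be a natural number, let $x_1,\ldots,x_n\in[0,1]$, let $L>0$, and let $\varphi\colon[0,1]^n\to\mathbb{R}$ be a convex function that is $L$-Lipschitz with respect to the Euclidean norm. Let $\pi$ be a uniformly distributed random permutation of $\{1,\ldots,n\}$ and put $Z=\varphi(x_{\pi(1)},\ldots,x_{\pi(n)})$. Then for all $t>0$, $$\mathbb{P}\big(|Z-\mathbb{E}Z|\ge t\big)\le 2\exp\!\big(-ct^2/L^2\big).$$ -/

import Mathlib

open MeasureTheory
open scoped NNReal

/-- The cube `[0,1]ⁿ` inside Euclidean space `ℝⁿ` (so that distances are Euclidean). -/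
def unitCube (n : ℕ) : Set (EuclideanSpace ℝ (Fin n)) :=
  {y | ∀ i, y i ∈ Set.Icc (0 : ℝ) 1}

/-- `π` is a random permutation of `n` letters, defined on `(Ω, P)`, whose law is uniform:
each of the `n!` permutations is taken with probability `1 / n!`. -/
def IsUniformPermutation {Ω : Type*} [MeasurableSpace Ω] (P : Measure Ω) {n : ℕ}
    (π : Ω → Equiv.Perm (Fin n)) : Prop :=
  ∀ σ : Equiv.Perm (Fin n),
    MeasurableSet {ω | π ω = σ} ∧ P.real {ω | π ω = σ} = 1 / (n.factorial : ℝ)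

/-- The vector `(x_{σ(1)}, …, x_{σ(n)})`. -/
def permuted {n : ℕ} (x : EuclideanSpace ℝ (Fin n)) (σ : Equiv.Perm (Fin n)) :
    EuclideanSpace ℝ (Fin n) :=
  WithLp.toLp 2 (fun i => x (σ i))

/-! The proof is the entropy method on the symmetric group. Random transpositions satisfy a modified
logarithmic Sobolev inequality (`entropy_exp_le`): the entropy of `exp f` is at most the mean of
`exp f` times `1/n` of the sum, over ordered pairs `(i, j)`, of the squared one-sided increments of
`f`. Herbst's argument (`log_permAvg_exp_le`) integrates such bounds into Laplace transform
estimates.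

For a convex `L`-Lipschitz function the one-sided sum is at most `2nL²`
(`sum_sum_sq_sub_permuted_le`). This serves the upper tail at every scale, but the lower tail only
for Laplace parameters of order `1/L`, since reversing the increments costs an exponential factor.
Hence the detour through Talagrand's convex distance: the squared distance `F` to a closed convex
`K` inside the cube is self-bounding (its one-sided sum is at most `8nF`), which gives `P(K) · E
exp(F/52) ≤ 1` (`exists_sq_dist_exp_moment_le`).

With `K` a sublevel set of `φ`, sublevel and superlevel sets at distance `b - a` have probabilities
whose product is at most `exp(-(b-a)²/(52L²))`. The crude Laplace bounds show that `φ ≤ m + 5L` and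
`φ ≥ m - 5L` each have probability at least `1/2`, `m` being the mean, so both tails around `m`
follow. -/

/-! ### Modified logarithmic Sobolev inequality for random transpositions. -/

section LogSobolev

/-- The symmetric relative-entropy kernel `(a - b)(log a - log b)`. -/
noncomputable def logKernel (a b : ℝ) : ℝ := (a - b) * (Real.log a - Real.log b)

theorem logKernel_self (a : ℝ) : logKernel a a = 0 := by simp [logKernel]

theorem logKernel_smul {c a b : ℝ} (hc : 0 < c) (ha : 0 < a) (hb : 0 < b) :
    logKernel (c * a) (c * b) = c * logKernel a b := by
  unfold logKernel
  rw [Real.log_mul hc.ne' ha.ne', Real.log_mul hc.ne' hb.ne']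
  ring

/-- The log-sum inequality. -/
theorem sum_mul_log_sub_log_le {ι : Type*} (s : Finset ι) (a b : ι → ℝ)
    (hs : s.Nonempty) (ha : ∀ i ∈ s, 0 < a i) (hb : ∀ i ∈ s, 0 < b i) :
    (∑ i ∈ s, a i) * (Real.log (∑ i ∈ s, a i) - Real.log (∑ i ∈ s, b i)) ≤
      ∑ i ∈ s, a i * (Real.log (a i) - Real.log (b i)) := by
  have hA : 0 < ∑ i ∈ s, a i := Finset.sum_pos ha hs
  have hB : 0 < ∑ i ∈ s, b i := Finset.sum_pos hb hs
  set A := ∑ i ∈ s, a i with hAdef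
  set B := ∑ i ∈ s, b i with hBdef
  have key : ∀ i ∈ s, a i * (Real.log A - Real.log B) + a i - b i * (A / B) ≤
      a i * (Real.log (a i) - Real.log (b i)) := by
    intro i hi
    have hai := ha i hi
    have hbi := hb i hi
    -- The tangent bound `log y ≤ y - 1` at the ratio of `b i / B` to `a i / A`; the linear terms
    -- cancel after summation.
    have h := Real.log_le_sub_one_of_pos (x := b i * A / (a i * B)) (by positivity)
    rw [Real.log_div (by positivity) (by positivity), Real.log_mul hbi.ne' hA.ne',
      Real.log_mul hai.ne' hB.ne'] at h
    have h2 := mul_le_mul_of_nonneg_left h hai.le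
    have h3 : a i * (b i * A / (a i * B) - 1) = b i * (A / B) - a i := by
      field_simp
    rw [h3] at h2
    linarith
  have h := Finset.sum_le_sum key
  rw [Finset.sum_sub_distrib, Finset.sum_add_distrib, ← Finset.sum_mul, ← Finset.sum_mul,
    ← hAdef, ← hBdef] at h
  have : B * (A / B) = A := by field_simp
  linarith

/-- Subadditivity of `logKernel`. -/
theorem logKernel_sum_le {ι : Type*} (s : Finset ι) (a b : ι → ℝ)
    (hs : s.Nonempty) (ha : ∀ i ∈ s, 0 < a i) (hb : ∀ i ∈ s, 0 < b i) :
    logKernel (∑ i ∈ s, a i) (∑ i ∈ s, b i) ≤ ∑ i ∈ s, logKernel (a i) (b i) := by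
  have h1 := sum_mul_log_sub_log_le s a b hs ha hb
  have h2 := sum_mul_log_sub_log_le s b a hs hb ha
  have h3 : ∑ i ∈ s, logKernel (a i) (b i) =
      ∑ i ∈ s, a i * (Real.log (a i) - Real.log (b i)) +
        ∑ i ∈ s, b i * (Real.log (b i) - Real.log (a i)) := by
    rw [← Finset.sum_add_distrib]
    exact Finset.sum_congr rfl fun i _ => by unfold logKernel; ring
  rw [h3]
  unfold logKernel
  linarith

/-- Summing a symmetric array over all sets `S.erase k`. -/
theorem sum_sum_erase {ι : Type*} [DecidableEq ι] (S : Finset ι) (e : ι → ι → ℝ) (h0 : ∀ i, e i i = 0)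
    (hs : ∀ i j, e i j = e j i) :
    ∑ k ∈ S, ∑ i ∈ S.erase k, ∑ j ∈ S.erase k, e i j =
      (S.card - 2) * ∑ i ∈ S, ∑ j ∈ S, e i j := by
  have h : ∀ k ∈ S, ∑ i ∈ S.erase k, ∑ j ∈ S.erase k, e i j =
      ∑ i ∈ S, ∑ j ∈ S, e i j - 2 * ∑ j ∈ S, e k j := by
    intro k hk
    have h1 : ∀ i, ∑ j ∈ S.erase k, e i j = ∑ j ∈ S, e i j - e i k := fun i =>
      Finset.sum_erase_eq_sub hk
    simp only [h1, Finset.sum_sub_distrib, Finset.sum_erase_eq_sub hk]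
    rw [h0, Finset.sum_congr rfl fun i _ => hs i k]
    ring
  rw [Finset.sum_congr rfl h, Finset.sum_sub_distrib, Finset.sum_const, nsmul_eq_mul,
    ← Finset.mul_sum]
  ring

variable {α : Type*} [Fintype α] [DecidableEq α]

/-- The permutations that move only elements of `S`. -/
def permsOn (S : Finset α) : Finset (Equiv.Perm α) :=
  Finset.univ.filter fun ρ => ∀ i ∉ S, ρ i = i

theorem mem_permsOn {S : Finset α} {ρ : Equiv.Perm α} :
    ρ ∈ permsOn S ↔ ∀ i ∉ S, ρ i = i := by simp [permsOn]

theorem permsOn_nonempty (S : Finset α) : (permsOn S).Nonempty :=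
  ⟨1, mem_permsOn.2 fun _ _ => rfl⟩

theorem permsOn_empty : permsOn (∅ : Finset α) = {1} := by
  ext ρ
  simp only [mem_permsOn, Finset.mem_singleton]
  refine ⟨fun h => Equiv.ext fun i => h i (by simp), ?_⟩
  rintro rfl i _
  rfl

theorem permsOn_univ : permsOn (Finset.univ : Finset α) = Finset.univ := by
  ext ρ; simp [mem_permsOn]

theorem permsOn_apply_mem {S : Finset α} {ρ : Equiv.Perm α} (h : ρ ∈ permsOn S) {i : α}
    (hi : i ∈ S) : ρ i ∈ S := by
  by_contra hn
  have h1 := mem_permsOn.1 h _ hn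
  exact hn (by rwa [ρ.injective h1])

theorem swap_mem_permsOn {S : Finset α} {k j : α} (hk : k ∈ S) (hj : j ∈ S) :
    Equiv.swap k j ∈ permsOn S := by
  refine mem_permsOn.2 fun i hi => Equiv.swap_apply_of_ne_of_ne ?_ ?_
  · rintro rfl; exact hi hk
  · rintro rfl; exact hi hj

theorem mul_mem_permsOn {S : Finset α} {ρ τ : Equiv.Perm α} (hρ : ρ ∈ permsOn S)
    (hτ : τ ∈ permsOn S) : ρ * τ ∈ permsOn S := by
  refine mem_permsOn.2 fun i hi => ?_
  rw [Equiv.Perm.mul_apply, mem_permsOn.1 hτ i hi, mem_permsOn.1 hρ i hi]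

theorem inv_mem_permsOn {S : Finset α} {ρ : Equiv.Perm α} (hρ : ρ ∈ permsOn S) :
    ρ⁻¹ ∈ permsOn S := by
  refine mem_permsOn.2 fun i hi => ?_
  rw [Equiv.Perm.inv_eq_iff_eq, mem_permsOn.1 hρ i hi]

theorem permsOn_mono {S T : Finset α} (h : S ⊆ T) : permsOn S ⊆ permsOn T := fun _ hρ =>
  mem_permsOn.2 fun i hi => mem_permsOn.1 hρ i fun hs => hi (h hs)

/-- Coset decomposition of `permsOn S` according to the image of a point `k ∈ S`. -/
theorem sum_permsOn {S : Finset α} {k : α} (hk : k ∈ S) (F : Equiv.Perm α → ℝ) :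
    ∑ ρ ∈ permsOn S, F ρ =
      ∑ j ∈ S, ∑ ρ ∈ permsOn (S.erase k), F (Equiv.swap k j * ρ) := by
  rw [← Finset.sum_product']
  symm
  refine Finset.sum_bij' (fun p _ => Equiv.swap k p.1 * p.2)
    (fun ρ _ => (ρ k, Equiv.swap k (ρ k) * ρ)) ?_ ?_ ?_ ?_ ?_
  · rintro ⟨j, ρ⟩ h
    rw [Finset.mem_product] at h
    exact mul_mem_permsOn (swap_mem_permsOn hk h.1) (permsOn_mono (Finset.erase_subset _ _) h.2)
  · intro ρ h
    refine Finset.mem_product.2 ⟨permsOn_apply_mem h hk, mem_permsOn.2 fun i hi => ?_⟩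
    rw [Finset.mem_erase, not_and_or, not_not] at hi
    rcases hi with rfl | hi
    · simp
    · exact mem_permsOn.1 (mul_mem_permsOn (swap_mem_permsOn hk (permsOn_apply_mem h hk)) h) i hi
  · rintro ⟨j, ρ⟩ h
    rw [Finset.mem_product] at h
    have hρk : ρ k = k := mem_permsOn.1 h.2 k (by simp)
    simp [Equiv.Perm.mul_apply, hρk, ← mul_assoc]
  · intro ρ h
    simp [← mul_assoc]
  · intros; rfl

/-- The average of `g` over the coset `σ * permsOn S`. -/
noncomputable def localAvg (S : Finset α) (g : Equiv.Perm α → ℝ) (σ : Equiv.Perm α) : ℝ :=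
  (∑ ρ ∈ permsOn S, g (σ * ρ)) / (permsOn S).card

theorem card_permsOn_pos (S : Finset α) : (0 : ℝ) < (permsOn S).card := by
  exact_mod_cast (permsOn_nonempty S).card_pos

theorem card_permsOn {S : Finset α} {k : α} (hk : k ∈ S) :
    ((permsOn S).card : ℝ) = S.card * (permsOn (S.erase k)).card := by
  have h := sum_permsOn hk (fun _ => (1 : ℝ))
  simpa using h

theorem localAvg_pos {S : Finset α} {g : Equiv.Perm α → ℝ} (hg : ∀ σ, 0 < g σ)
    (σ : Equiv.Perm α) : 0 < localAvg S g σ :=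
  div_pos (Finset.sum_pos (fun _ _ => hg _) (permsOn_nonempty S)) (card_permsOn_pos S)

theorem localAvg_empty (g : Equiv.Perm α → ℝ) (σ : Equiv.Perm α) : localAvg ∅ g σ = g σ := by
  simp [localAvg, permsOn_empty]

theorem localAvg_univ (g : Equiv.Perm α → ℝ) (σ : Equiv.Perm α) :
    localAvg Finset.univ g σ = (∑ τ, g τ) / Fintype.card (Equiv.Perm α) := by
  rw [localAvg, permsOn_univ, Finset.card_univ, ← Equiv.sum_comp (Equiv.mulLeft σ) g]
  rfl

theorem localAvg_eq_sum {S : Finset α} {k : α} (hk : k ∈ S) (g : Equiv.Perm α → ℝ)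
    (σ : Equiv.Perm α) :
    localAvg S g σ = (∑ j ∈ S, localAvg (S.erase k) g (σ * Equiv.swap k j)) / S.card := by
  have h1 := card_permsOn_pos (S.erase k)
  have h2 : (0 : ℝ) < S.card := by exact_mod_cast Finset.card_pos.2 ⟨k, hk⟩
  unfold localAvg
  rw [sum_permsOn hk, card_permsOn hk, ← Finset.sum_div]
  simp only [mul_assoc]
  field_simp

theorem localAvg_mul_right {S : Finset α} {τ : Equiv.Perm α} (hτ : τ ∈ permsOn S)
    (g : Equiv.Perm α → ℝ) (σ : Equiv.Perm α) : localAvg S g (σ * τ) = localAvg S g σ := by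
  unfold localAvg
  congr 1
  refine Finset.sum_bij' (fun ρ _ => τ * ρ) (fun ρ _ => τ⁻¹ * ρ)
    (fun ρ h => mul_mem_permsOn hτ h) (fun ρ h => mul_mem_permsOn (inv_mem_permsOn hτ) h)
    ?_ ?_ ?_ <;> intros <;> simp [mul_assoc]

/-- One step of the entropy chain rule: averaging over `permsOn S` is averaging over `permsOn
(S.erase k)` followed by a uniform swap of `k` with a point of `S`. Concavity of `log` bounds the
entropy of that swap, and subadditivity of `logKernel` replaces the local average by `g` itself. -/
theorem sum_localAvg_mul_log_sub_le {S : Finset α} {k : α} (hk : k ∈ S) {g : Equiv.Perm α → ℝ}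
    (hg : ∀ σ, 0 < g σ) :
    ∑ σ, localAvg (S.erase k) g σ * Real.log (localAvg (S.erase k) g σ) -
        ∑ σ, localAvg S g σ * Real.log (localAvg S g σ) ≤
      (∑ j ∈ S, ∑ σ, logKernel (g σ) (g (σ * Equiv.swap k j))) / (2 * S.card) := by
  set h := localAvg (S.erase k) g with hh
  set H := localAvg S g with hH
  have hm : (0 : ℝ) < S.card := by exact_mod_cast Finset.card_pos.2 ⟨k, hk⟩
  have hpos : ∀ σ, 0 < h σ := localAvg_pos hg
  have hHpos : ∀ σ, 0 < H σ := localAvg_pos hg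
  have hHavg : ∀ σ, H σ = (∑ j ∈ S, h (σ * Equiv.swap k j)) / S.card := localAvg_eq_sum hk g
  -- `H` is unchanged by right multiplication by these swaps, and `H` is the average of `h` over
  -- them.
  have hcross : ∑ σ, H σ * Real.log (H σ) = ∑ σ, h σ * Real.log (H σ) := by
    have e1 : ∀ j ∈ S, ∑ σ, h (σ * Equiv.swap k j) * Real.log (H σ) =
        ∑ σ, h σ * Real.log (H σ) := by
      intro j hj
      rw [← Equiv.sum_comp (Equiv.mulRight (Equiv.swap k j)) (fun σ => h σ * Real.log (H σ))]
      refine Finset.sum_congr rfl fun σ _ => ?_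
      simp only [Equiv.coe_mulRight]
      rw [hH, localAvg_mul_right (swap_mem_permsOn hk hj)]
    calc ∑ σ, H σ * Real.log (H σ)
        = ∑ σ, (∑ j ∈ S, h (σ * Equiv.swap k j) * Real.log (H σ)) / S.card := by
          refine Finset.sum_congr rfl fun σ _ => ?_
          rw [← Finset.sum_mul, mul_div_right_comm, ← hHavg]
      _ = (∑ j ∈ S, ∑ σ, h (σ * Equiv.swap k j) * Real.log (H σ)) / S.card := by
          rw [← Finset.sum_div, Finset.sum_comm]
      _ = ∑ σ, h σ * Real.log (H σ) := by
          rw [Finset.sum_congr rfl e1, Finset.sum_const, nsmul_eq_mul]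
          field_simp
  have hconc : ∀ σ, (∑ j ∈ S, Real.log (h (σ * Equiv.swap k j))) / S.card ≤ Real.log (H σ) := by
    intro σ
    have := strictConcaveOn_log_Ioi.concaveOn.le_map_sum (t := S) (w := fun _ => (S.card : ℝ)⁻¹)
      (p := fun j => h (σ * Equiv.swap k j)) (fun _ _ => by positivity)
      (by rw [Finset.sum_const, nsmul_eq_mul]; field_simp) (fun j _ => hpos _)
    simp only [smul_eq_mul, ← Finset.mul_sum] at this
    rw [hHavg, div_eq_inv_mul, div_eq_inv_mul]
    exact this
  have hsymm : ∀ j, ∑ σ, h σ * (Real.log (h σ) - Real.log (h (σ * Equiv.swap k j))) =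
      (∑ σ, logKernel (h σ) (h (σ * Equiv.swap k j))) / 2 := by
    intro j
    have e := Equiv.sum_comp (Equiv.mulRight (Equiv.swap k j))
      (fun σ => h σ * (Real.log (h σ) - Real.log (h (σ * Equiv.swap k j))))
    simp only [Equiv.coe_mulRight, mul_assoc, Equiv.swap_mul_self, mul_one] at e
    have : ∑ σ, logKernel (h σ) (h (σ * Equiv.swap k j)) =
        ∑ σ, h σ * (Real.log (h σ) - Real.log (h (σ * Equiv.swap k j))) +
        ∑ σ, h (σ * Equiv.swap k j) * (Real.log (h (σ * Equiv.swap k j)) - Real.log (h σ)) := by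
      rw [← Finset.sum_add_distrib]
      exact Finset.sum_congr rfl fun σ _ => by unfold logKernel; ring
    rw [this, e]
    ring
  have hjensen : ∑ j ∈ S, ∑ σ, logKernel (h σ) (h (σ * Equiv.swap k j)) ≤
      ∑ j ∈ S, ∑ σ, logKernel (g σ) (g (σ * Equiv.swap k j)) := by
    set R := permsOn (S.erase k) with hR
    have hc : (0 : ℝ) < R.card := card_permsOn_pos _
    -- Every `ρ ∈ R` fixes `k`, so conjugation by it only relabels the other point of the swap;
    -- summing over all `j ∈ S` absorbs the relabelling.
    have hconj : ∀ ρ ∈ R, ∀ j, Equiv.swap k j * ρ = ρ * Equiv.swap k (ρ⁻¹ j) := by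
      intro ρ hρ j
      have hρk : ρ⁻¹ k = k := mem_permsOn.1 (inv_mem_permsOn hρ) k (by simp)
      have := Equiv.swap_apply_apply ρ⁻¹ k j
      rw [hρk] at this
      rw [this]
      group
    have hle : ∀ j σ, logKernel (h σ) (h (σ * Equiv.swap k j)) ≤
        (R.card : ℝ)⁻¹ * ∑ ρ ∈ R, logKernel (g (σ * ρ)) (g (σ * ρ * Equiv.swap k (ρ⁻¹ j))) := by
      intro j σ
      have e1 : h σ = (R.card : ℝ)⁻¹ * ∑ ρ ∈ R, g (σ * ρ) := by
        rw [hh, localAvg, div_eq_inv_mul]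
      have e2 : h (σ * Equiv.swap k j) =
          (R.card : ℝ)⁻¹ * ∑ ρ ∈ R, g (σ * ρ * Equiv.swap k (ρ⁻¹ j)) := by
        rw [hh, localAvg, div_eq_inv_mul]
        congr 1
        refine Finset.sum_congr rfl fun ρ hρ => ?_
        rw [mul_assoc, mul_assoc, hconj ρ hρ j]
      rw [e1, e2, logKernel_smul (by positivity)
        (Finset.sum_pos (fun _ _ => hg _) (permsOn_nonempty _))
        (Finset.sum_pos (fun _ _ => hg _) (permsOn_nonempty _))]
      exact mul_le_mul_of_nonneg_left
        (logKernel_sum_le _ _ _ (permsOn_nonempty _) (fun _ _ => hg _) (fun _ _ => hg _))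
        (by positivity)
    calc ∑ j ∈ S, ∑ σ, logKernel (h σ) (h (σ * Equiv.swap k j))
        ≤ ∑ j ∈ S, ∑ σ, (R.card : ℝ)⁻¹ *
            ∑ ρ ∈ R, logKernel (g (σ * ρ)) (g (σ * ρ * Equiv.swap k (ρ⁻¹ j))) :=
          Finset.sum_le_sum fun j _ => Finset.sum_le_sum fun σ _ => hle j σ
      _ = (R.card : ℝ)⁻¹ * ∑ ρ ∈ R, ∑ j ∈ S, ∑ σ,
            logKernel (g (σ * ρ)) (g (σ * ρ * Equiv.swap k (ρ⁻¹ j))) := by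
          simp only [← Finset.mul_sum]
          congr 1
          rw [Finset.sum_comm]
          conv_rhs => rw [Finset.sum_congr rfl fun ρ _ => Finset.sum_comm, Finset.sum_comm]
          refine Finset.sum_congr rfl fun σ _ => ?_
          rw [Finset.sum_comm]
      _ = (R.card : ℝ)⁻¹ * ∑ ρ ∈ R, ∑ j ∈ S, ∑ σ, logKernel (g σ) (g (σ * Equiv.swap k j)) := by
          congr 1
          refine Finset.sum_congr rfl fun ρ hρ => ?_
          have hρS := permsOn_mono (Finset.erase_subset _ _) hρ
          refine Finset.sum_bij' (fun j _ => ρ⁻¹ j) (fun j _ => ρ j)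
            (fun j hj => permsOn_apply_mem (inv_mem_permsOn hρS) hj)
            (fun j hj => permsOn_apply_mem hρS hj) (by simp) (by simp) ?_
          intro j _
          exact Equiv.sum_comp (Equiv.mulRight ρ)
            (fun σ => logKernel (g σ) (g (σ * Equiv.swap k (ρ⁻¹ j))))
      _ = _ := by
          rw [Finset.sum_const, nsmul_eq_mul]
          field_simp
  calc ∑ σ, h σ * Real.log (h σ) - ∑ σ, H σ * Real.log (H σ)
      = ∑ σ, h σ * (Real.log (h σ) - Real.log (H σ)) := by
        rw [hcross, ← Finset.sum_sub_distrib]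
        exact Finset.sum_congr rfl fun σ _ => by ring
    _ ≤ ∑ σ, h σ * (Real.log (h σ) - (∑ j ∈ S, Real.log (h (σ * Equiv.swap k j))) / S.card) := by
        refine Finset.sum_le_sum fun σ _ => mul_le_mul_of_nonneg_left ?_ (hpos σ).le
        linarith [hconc σ]
    _ = (∑ j ∈ S, ∑ σ, h σ * (Real.log (h σ) - Real.log (h (σ * Equiv.swap k j)))) / S.card := by
        rw [Finset.sum_comm, Finset.sum_div]
        refine Finset.sum_congr rfl fun σ _ => ?_
        rw [← Finset.mul_sum, Finset.sum_sub_distrib, Finset.sum_const, nsmul_eq_mul]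
        field_simp
    _ = (∑ j ∈ S, ∑ σ, logKernel (h σ) (h (σ * Equiv.swap k j))) / (2 * S.card) := by
        rw [Finset.sum_congr rfl fun j _ => hsymm j, ← Finset.sum_div]
        field_simp
    _ ≤ _ := by gcongr

/-- Induction on `S.card`. Removing a fixed point at each stage would weight pairs unevenly, so the
one-step bound is averaged over all choices of `k`, which restores the symmetric sum over pairs. -/
theorem sum_mul_log_sub_localAvg_le (S : Finset α) {g : Equiv.Perm α → ℝ} (hg : ∀ σ, 0 < g σ) :
    ∑ σ, g σ * Real.log (g σ) - ∑ σ, localAvg S g σ * Real.log (localAvg S g σ) ≤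
      (∑ i ∈ S, ∑ j ∈ S, ∑ σ, logKernel (g σ) (g (σ * Equiv.swap i j))) / (2 * S.card) := by
  induction hm : S.card generalizing S with
  | zero =>
    rw [Finset.card_eq_zero] at hm
    subst hm
    simp [localAvg_empty]
  | succ m ih =>
    set e : α → α → ℝ := fun i j => ∑ σ, logKernel (g σ) (g (σ * Equiv.swap i j)) with he
    set Q := ∑ i ∈ S, ∑ j ∈ S, e i j with hQ
    have he0 : ∀ i, e i i = 0 := fun i => Finset.sum_eq_zero fun σ _ => by
      rw [Equiv.swap_self]
      exact logKernel_self _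
    have hes : ∀ i j, e i j = e j i := fun i j => by simp only [he, Equiv.swap_comm]
    have hen : ∀ i j, 0 ≤ e i j := fun i j => by
      refine Finset.sum_nonneg fun σ _ => ?_
      unfold logKernel
      rcases le_total (g σ) (g (σ * Equiv.swap i j)) with h | h
      · have := Real.log_le_log (hg _) h
        nlinarith
      · have := Real.log_le_log (hg _) h
        nlinarith
    have hQ0 : 0 ≤ Q := Finset.sum_nonneg fun i _ => Finset.sum_nonneg fun j _ => hen i j
    set X := ∑ σ, g σ * Real.log (g σ) - ∑ σ, localAvg S g σ * Real.log (localAvg S g σ) with hX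
    have step : ∀ k ∈ S, X ≤ (∑ i ∈ S.erase k, ∑ j ∈ S.erase k, e i j) / (2 * (m : ℝ)) +
        (∑ j ∈ S, e k j) / (2 * (m + 1 : ℝ)) := by
      intro k hk
      have h1 := ih (S.erase k) (by rw [Finset.card_erase_of_mem hk, hm]; rfl)
      have h2 := sum_localAvg_mul_log_sub_le hk hg
      rw [hm] at h2
      push_cast at h2
      linarith
    have hsum := Finset.sum_le_sum step
    rw [Finset.sum_const, nsmul_eq_mul, Finset.sum_add_distrib, ← Finset.sum_div,
      ← Finset.sum_div, sum_sum_erase S e he0 hes, ← hQ, hm] at hsum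
    push_cast at hsum ⊢
    rw [le_div_iff₀ (by positivity)]
    -- For `m = 0` the first quotient is `0` by the convention on division by zero; otherwise the
    -- slack is exactly `Q / (2m(m+1))`.
    have hfin : ((m : ℝ) + 1 - 2) * Q / (2 * m) + Q / (2 * (m + 1)) ≤ Q / 2 := by
      rcases Nat.eq_zero_or_pos m with rfl | hmpos
      · norm_num
      · have hm' : (0 : ℝ) < m := by exact_mod_cast hmpos
        have : Q / 2 - (((m : ℝ) + 1 - 2) * Q / (2 * m) + Q / (2 * (m + 1))) =
            Q / (2 * m * (m + 1)) := by
          field_simp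
          ring
        have h3 : 0 ≤ Q / (2 * m * (m + 1)) := by positivity
        linarith
    linarith

theorem logKernel_exp_le (a b : ℝ) :
    logKernel (Real.exp a) (Real.exp b) ≤
      (max (a - b) 0) ^ 2 * Real.exp a + (max (b - a) 0) ^ 2 * Real.exp b := by
  have key : ∀ a b : ℝ, b ≤ a → (Real.exp a - Real.exp b) * (a - b) ≤ (a - b) ^ 2 * Real.exp a := by
    intro a b h
    have h1 := Real.add_one_le_exp (b - a)
    rw [Real.exp_sub, le_div_iff₀ (Real.exp_pos a)] at h1
    have : Real.exp a - Real.exp b ≤ (a - b) * Real.exp a := by linarith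
    nlinarith [mul_le_mul_of_nonneg_right this (sub_nonneg.2 h)]
  unfold logKernel
  rw [Real.log_exp, Real.log_exp]
  rcases le_total b a with h | h
  · rw [max_eq_left (sub_nonneg.2 h), max_eq_right (by linarith)]
    linarith [key a b h]
  · rw [max_eq_left (sub_nonneg.2 h), max_eq_right (by linarith)]
    linarith [key b a h]

/-- Average of a function over the symmetric group. -/
noncomputable def permAvg (f : Equiv.Perm α → ℝ) : ℝ :=
  (∑ σ, f σ) / Fintype.card (Equiv.Perm α)

/-- Modified logarithmic Sobolev inequality for random transpositions. -/
theorem entropy_exp_le (f : Equiv.Perm α → ℝ) :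
    permAvg (fun σ => f σ * Real.exp (f σ)) -
        permAvg (fun σ => Real.exp (f σ)) * Real.log (permAvg fun σ => Real.exp (f σ)) ≤
      permAvg (fun σ => (∑ i, ∑ j, (max (f σ - f (σ * Equiv.swap i j)) 0) ^ 2) *
        Real.exp (f σ)) / Fintype.card α := by
  have hN : (0 : ℝ) < Fintype.card (Equiv.Perm α) := by exact_mod_cast Fintype.card_pos
  have h := sum_mul_log_sub_localAvg_le (Finset.univ : Finset α) (g := fun σ => Real.exp (f σ))
    (fun σ => Real.exp_pos _)
  have hb : ∀ i j : α, ∑ σ, logKernel (Real.exp (f σ)) (Real.exp (f (σ * Equiv.swap i j))) ≤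
      2 * ∑ σ, (max (f σ - f (σ * Equiv.swap i j)) 0) ^ 2 * Real.exp (f σ) := by
    intro i j
    refine (Finset.sum_le_sum fun σ _ => logKernel_exp_le _ _).trans ?_
    rw [Finset.sum_add_distrib, two_mul]
    -- The substitution `σ ↦ σ * swap i j` exchanges the two one-sided terms; the resulting factor
    -- `2` cancels the one in the denominator.
    have e := Equiv.sum_comp (Equiv.mulRight (Equiv.swap i j))
      (fun σ => (max (f σ - f (σ * Equiv.swap i j)) 0) ^ 2 * Real.exp (f σ))
    simp only [Equiv.coe_mulRight, mul_assoc, Equiv.swap_mul_self, mul_one] at e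
    rw [e]
  have h' := h.trans (div_le_div_of_nonneg_right
    (Finset.sum_le_sum fun i _ => Finset.sum_le_sum fun j _ => hb i j) (by positivity))
  simp only [localAvg_univ, Real.log_exp, Finset.sum_const, nsmul_eq_mul, Finset.card_univ] at h'
  rw [← div_le_div_iff_of_pos_right hN] at h'
  have hL : permAvg (fun σ => f σ * Real.exp (f σ)) -
        permAvg (fun σ => Real.exp (f σ)) * Real.log (permAvg fun σ => Real.exp (f σ)) =
      (∑ σ, Real.exp (f σ) * f σ - Fintype.card (Equiv.Perm α) * ((∑ σ, Real.exp (f σ)) /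
        Fintype.card (Equiv.Perm α) * Real.log ((∑ σ, Real.exp (f σ)) /
        Fintype.card (Equiv.Perm α)))) / Fintype.card (Equiv.Perm α) := by
    unfold permAvg
    rw [Finset.sum_congr rfl fun σ _ => mul_comm (f σ) _]
    field_simp
  rw [hL]
  refine h'.trans (le_of_eq ?_)
  unfold permAvg
  have hR : ∑ σ, (∑ i, ∑ j, (max (f σ - f (σ * Equiv.swap i j)) 0) ^ 2) * Real.exp (f σ) =
      ∑ i, ∑ j, ∑ σ, (max (f σ - f (σ * Equiv.swap i j)) 0) ^ 2 * Real.exp (f σ) := by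
    simp only [Finset.sum_mul]
    rw [Finset.sum_comm]
    exact Finset.sum_congr rfl fun i _ => Finset.sum_comm
  rw [hR]
  simp only [← Finset.mul_sum]
  rw [mul_div_mul_left _ _ (two_ne_zero), div_right_comm]

end LogSobolev

/-! ### Herbst's argument and entropy bounds for both signs of the exponent. -/

section Herbst

variable {α : Type*} [Fintype α] [DecidableEq α]

theorem card_perm_pos : (0 : ℝ) < Fintype.card (Equiv.Perm α) := by
  exact_mod_cast Fintype.card_pos

theorem permAvg_mono {f g : Equiv.Perm α → ℝ} (h : ∀ σ, f σ ≤ g σ) : permAvg f ≤ permAvg g :=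
  div_le_div_of_nonneg_right (Finset.sum_le_sum fun σ _ => h σ) card_perm_pos.le

theorem permAvg_pos {f : Equiv.Perm α → ℝ} (h : ∀ σ, 0 < f σ) : 0 < permAvg f :=
  div_pos (Finset.sum_pos (fun σ _ => h σ) Finset.univ_nonempty) card_perm_pos

theorem permAvg_nonneg {f : Equiv.Perm α → ℝ} (h : ∀ σ, 0 ≤ f σ) : 0 ≤ permAvg f :=
  div_nonneg (Finset.sum_nonneg fun σ _ => h σ) card_perm_pos.le

theorem permAvg_const (c : ℝ) : permAvg (fun _ : Equiv.Perm α => c) = c := by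
  have := card_perm_pos (α := α)
  rw [permAvg, Finset.sum_const, nsmul_eq_mul, Finset.card_univ]
  field_simp

theorem permAvg_const_mul (c : ℝ) (f : Equiv.Perm α → ℝ) :
    permAvg (fun σ => c * f σ) = c * permAvg f := by
  rw [permAvg, ← Finset.mul_sum, mul_div_assoc, permAvg]

theorem permAvg_neg (f : Equiv.Perm α → ℝ) : permAvg (fun σ => -f σ) = -permAvg f := by
  rw [permAvg, Finset.sum_neg_distrib, neg_div, permAvg]

theorem permAvg_sum {ι : Type*} (s : Finset ι) (f : ι → Equiv.Perm α → ℝ) :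
    permAvg (fun σ => ∑ i ∈ s, f i σ) = ∑ i ∈ s, permAvg (f i) := by
  simp only [permAvg]
  rw [Finset.sum_comm, Finset.sum_div]

theorem permAvg_mul_right (τ : Equiv.Perm α) (f : Equiv.Perm α → ℝ) :
    permAvg (fun σ => f (σ * τ)) = permAvg f := by
  unfold permAvg
  rw [← Equiv.sum_comp (Equiv.mulRight τ) f]
  rfl

/-- Herbst's argument: an entropy bound integrates to a bound on the log-Laplace transform. -/
theorem log_permAvg_exp_le (F : Equiv.Perm α → ℝ) {a b l : ℝ} (hl : 0 < l)
    (h : ∀ u, 0 < u → u ≤ l →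
      permAvg (fun σ => u * F σ * Real.exp (u * F σ)) -
        permAvg (fun σ => Real.exp (u * F σ)) * Real.log (permAvg fun σ => Real.exp (u * F σ)) ≤
      u ^ 2 * (a * permAvg (fun σ => Real.exp (u * F σ)) +
        b * permAvg (fun σ => F σ * Real.exp (u * F σ)))) :
    Real.log (permAvg fun σ => Real.exp (l * F σ)) * (1 / l - b) ≤ permAvg F + a * l := by
  set M : ℝ → ℝ := fun u => permAvg fun σ => Real.exp (u * F σ) with hM
  set M' : ℝ → ℝ := fun u => permAvg fun σ => F σ * Real.exp (u * F σ) with hM'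
  have hMpos : ∀ u, 0 < M u := fun u => permAvg_pos fun σ => Real.exp_pos _
  have hder : ∀ u, HasDerivAt M (M' u) u := by
    intro u
    simp only [hM, hM', permAvg]
    refine HasDerivAt.div_const (HasDerivAt.fun_sum fun σ _ => ?_) _
    have := ((hasDerivAt_id u).mul_const (F σ)).exp
    simpa [mul_comm] using this
  set G : ℝ → ℝ := fun u => Real.log (M u) with hG
  have hGder : ∀ u, HasDerivAt G (M' u / M u) u := fun u => (hder u).log (hMpos u).ne'
  have hM0 : M 0 = 1 := by simp [hM, permAvg_const]
  have hG0 : G 0 = 0 := by simp [hG, hM0]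
  have hM'0 : M' 0 = permAvg F := by simp [hM']
  -- The hypothesis says exactly that `Φ' ≤ 0` on `(0, l]`. Since `G u / u` tends to `G' 0`, the
  -- limit of `Φ` at `0` is the mean of `F`.
  set Φ : ℝ → ℝ := fun u => G u / u - b * G u - a * u with hΦ
  have hΦder : ∀ u, 0 < u →
      HasDerivAt Φ ((M' u / M u * u - G u * 1) / u ^ 2 - b * (M' u / M u) - a * 1) u := by
    intro u hu
    exact (((hGder u).div (hasDerivAt_id u) hu.ne').sub ((hGder u).const_mul b)).sub
      ((hasDerivAt_id u).const_mul a)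
  have hanti : AntitoneOn Φ (Set.Ioc 0 l) := by
    refine antitoneOn_of_deriv_nonpos (convex_Ioc 0 l)
      (fun u hu => (hΦder u hu.1).continuousAt.continuousWithinAt)
      (fun u hu => (hΦder u (interior_subset hu).1).differentiableAt.differentiableWithinAt) ?_
    intro u hu
    have hu' := interior_subset hu
    have hu0 := hu'.1
    rw [(hΦder u hu0).deriv]
    have hh := h u hu0 hu'.2
    have e1 : permAvg (fun σ => u * F σ * Real.exp (u * F σ)) = u * M' u := by
      rw [hM', ← permAvg_const_mul]; simp only [mul_assoc]
    rw [e1] at hh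
    change u * M' u - M u * G u ≤ u ^ 2 * (a * M u + b * M' u) at hh
    have hm := hMpos u
    have : (M' u / M u * u - G u * 1) / u ^ 2 - b * (M' u / M u) - a * 1 =
        (u * M' u - M u * G u - u ^ 2 * (a * M u + b * M' u)) / (M u * u ^ 2) := by
      field_simp
      ring
    rw [this]
    exact div_nonpos_of_nonpos_of_nonneg (by linarith) (by positivity)
  have hlim : Filter.Tendsto Φ (nhdsWithin 0 (Set.Ioi 0)) (nhds (permAvg F)) := by
    have h1 := (hasDerivAt_iff_tendsto_slope.1 (hGder 0)).mono_left
      (nhdsWithin_mono 0 (fun u (hu : u ∈ Set.Ioi (0 : ℝ)) => (ne_of_gt hu : u ≠ 0)))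
    rw [hM0, hM'0, div_one] at h1
    have h2 : Filter.Tendsto (fun u => b * G u + a * u) (nhdsWithin 0 (Set.Ioi 0)) (nhds 0) := by
      have : ContinuousAt (fun u => b * G u + a * u) 0 :=
        ((hGder 0).continuousAt.const_mul b).add (continuousAt_id.const_mul a)
      have h3 := this.tendsto
      simp only [hG0, mul_zero, add_zero] at h3
      exact h3.mono_left nhdsWithin_le_nhds
    have h4 := h1.sub h2
    rw [sub_zero] at h4
    refine h4.congr fun u => ?_
    simp only [hΦ, slope_def_field, hG0, sub_zero]
    ring
  have hle : Φ l ≤ permAvg F := by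
    refine ge_of_tendsto hlim ?_
    filter_upwards [Ioc_mem_nhdsGT hl] with u hu
    exact hanti hu ⟨hl, le_rfl⟩ hu.2
  have hfin : Φ l = Real.log (M l) * (1 / l - b) - a * l := by
    simp only [hΦ, hG]; ring
  rw [hfin] at hle
  linarith

theorem entropy_exp_mul_le {F V : Equiv.Perm α → ℝ} (hV : ∀ σ, 0 ≤ V σ)
    (hF : ∀ σ, ∑ i, ∑ j, (max (F σ - F (σ * Equiv.swap i j)) 0) ^ 2 ≤ Fintype.card α * V σ)
    {u : ℝ} (hu : 0 < u) :
    permAvg (fun σ => u * F σ * Real.exp (u * F σ)) -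
        permAvg (fun σ => Real.exp (u * F σ)) * Real.log (permAvg fun σ => Real.exp (u * F σ)) ≤
      u ^ 2 * permAvg (fun σ => V σ * Real.exp (u * F σ)) := by
  refine (entropy_exp_le fun σ => u * F σ).trans ?_
  have hmax : ∀ σ τ, (max (u * F σ - u * F τ) 0) ^ 2 = u ^ 2 * (max (F σ - F τ) 0) ^ 2 := by
    intro σ τ
    rw [← mul_pow, mul_max_of_nonneg _ _ hu.le, mul_sub, mul_zero]
  have h0 : 0 ≤ permAvg (fun σ => V σ * Real.exp (u * F σ)) :=
    permAvg_nonneg fun σ => mul_nonneg (hV σ) (Real.exp_pos _).le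
  refine div_le_of_le_mul₀ (by positivity) (by positivity) ?_
  rw [mul_assoc, mul_comm (permAvg _), ← permAvg_const_mul, ← permAvg_const_mul]
  refine permAvg_mono fun σ => ?_
  simp only [hmax, ← Finset.mul_sum]
  have := mul_le_mul_of_nonneg_right (hF σ)
    (show 0 ≤ u ^ 2 * Real.exp (u * F σ) by positivity)
  linarith

/-- Negating `F` produces increments of the wrong sign. Reindexing by the swap restores the
one-sided increments of `F`, but moves the exponential weight to the swapped permutation; returning
it costs `exp (u * B)`. -/
theorem entropy_exp_neg_mul_le {F V : Equiv.Perm α → ℝ} {B : ℝ} (hV : ∀ σ, 0 ≤ V σ)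
    (hF : ∀ σ, ∑ i, ∑ j, (max (F σ - F (σ * Equiv.swap i j)) 0) ^ 2 ≤ Fintype.card α * V σ)
    (hB : ∀ σ i j, F σ - F (σ * Equiv.swap i j) ≤ B) {u : ℝ} (hu : 0 < u) :
    permAvg (fun σ => u * -F σ * Real.exp (u * -F σ)) -
        permAvg (fun σ => Real.exp (u * -F σ)) *
          Real.log (permAvg fun σ => Real.exp (u * -F σ)) ≤
      u ^ 2 * (Real.exp (u * B) * permAvg (fun σ => V σ * Real.exp (u * -F σ))) := by
  refine (entropy_exp_le fun σ => u * -F σ).trans ?_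
  have hmax : ∀ σ τ, (max (u * -F σ - u * -F τ) 0) ^ 2 = u ^ 2 * (max (F τ - F σ) 0) ^ 2 := by
    intro σ τ
    rw [← mul_pow, mul_max_of_nonneg _ _ hu.le, mul_zero]
    congr 2
    ring
  have h0 : 0 ≤ permAvg (fun σ => V σ * Real.exp (u * -F σ)) :=
    permAvg_nonneg fun σ => mul_nonneg (hV σ) (Real.exp_pos _).le
  refine div_le_of_le_mul₀ (by positivity) (by positivity) ?_
  have hswap : permAvg (fun σ => (∑ i, ∑ j,
        (max (u * -F σ - u * -F (σ * Equiv.swap i j)) 0) ^ 2) * Real.exp (u * -F σ)) =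
      permAvg (fun σ => ∑ i, ∑ j, u ^ 2 * (max (F σ - F (σ * Equiv.swap i j)) 0) ^ 2 *
        Real.exp (u * -F (σ * Equiv.swap i j))) := by
    simp only [hmax, Finset.sum_mul, permAvg_sum]
    refine Finset.sum_congr rfl fun i _ => Finset.sum_congr rfl fun j _ => ?_
    rw [← permAvg_mul_right (Equiv.swap i j)]
    simp only [mul_assoc, Equiv.swap_mul_self, mul_one]
  rw [hswap, mul_assoc, mul_assoc, mul_comm (permAvg _), ← permAvg_const_mul, ← permAvg_const_mul,
    ← permAvg_const_mul]
  refine permAvg_mono fun σ => ?_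
  have hterm : ∀ i j, u ^ 2 * (max (F σ - F (σ * Equiv.swap i j)) 0) ^ 2 *
      Real.exp (u * -F (σ * Equiv.swap i j)) ≤
      (u ^ 2 * (Real.exp (u * B) * Real.exp (u * -F σ))) *
        (max (F σ - F (σ * Equiv.swap i j)) 0) ^ 2 := by
    intro i j
    have h1 : Real.exp (u * -F (σ * Equiv.swap i j)) ≤ Real.exp (u * B) * Real.exp (u * -F σ) := by
      rw [← Real.exp_add, Real.exp_le_exp]
      have := mul_le_mul_of_nonneg_left (hB σ i j) hu.le
      linarith
    have h2 := mul_le_mul_of_nonneg_left h1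
      (show 0 ≤ u ^ 2 * (max (F σ - F (σ * Equiv.swap i j)) 0) ^ 2 by positivity)
    linarith
  refine (Finset.sum_le_sum fun i _ => Finset.sum_le_sum fun j _ => hterm i j).trans ?_
  simp only [← Finset.mul_sum]
  have := mul_le_mul_of_nonneg_left (hF σ)
    (show 0 ≤ u ^ 2 * (Real.exp (u * B) * Real.exp (u * -F σ)) by positivity)
  linarith

end Herbst

/-! ### Squared distance to a convex subset of the cube. -/

section ConvexDistance

variable {n : ℕ}

theorem permuted_mem_unitCube {x : EuclideanSpace ℝ (Fin n)} (hx : x ∈ unitCube n)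
    (σ : Equiv.Perm (Fin n)) : permuted x σ ∈ unitCube n := fun i => hx (σ i)

theorem convex_unitCube : Convex ℝ (unitCube n) := by
  intro y hy z hz a b ha hb hab i
  exact (convex_Icc (0 : ℝ) 1) (hy i) (hz i) ha hb hab

theorem isClosed_unitCube : IsClosed (unitCube n) := by
  have : unitCube n = ⋂ i, (fun y : EuclideanSpace ℝ (Fin n) => y i) ⁻¹' Set.Icc (0 : ℝ) 1 := by
    ext y; simp [unitCube]
  rw [this]
  exact isClosed_iInter fun i => isClosed_Icc.preimage (by fun_prop)

theorem abs_sub_le_one_of_mem_unitCube {y z : EuclideanSpace ℝ (Fin n)} (hy : y ∈ unitCube n)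
    (hz : z ∈ unitCube n) (i j : Fin n) : |y i - z j| ≤ 1 := by
  have h1 := hy i
  have h2 := hz j
  rw [abs_le]
  constructor <;> linarith [h1.1, h1.2, h2.1, h2.2]

theorem permuted_sub_permuted_mul_swap (x : EuclideanSpace ℝ (Fin n)) (σ : Equiv.Perm (Fin n))
    (i j : Fin n) :
    permuted x σ - permuted x (σ * Equiv.swap i j) =
      (permuted x σ i - permuted x σ j) •
        (EuclideanSpace.single i (1 : ℝ) - EuclideanSpace.single j (1 : ℝ)) := by
  ext l
  simp only [permuted, PiLp.sub_apply, PiLp.smul_apply, PiLp.single_apply, smul_eq_mul,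
    Equiv.Perm.mul_apply, Equiv.swap_apply_def]
  by_cases h1 : l = i <;> by_cases h2 : l = j <;> simp_all

theorem inner_permuted_sub (x v : EuclideanSpace ℝ (Fin n)) (σ : Equiv.Perm (Fin n))
    (i j : Fin n) :
    inner ℝ v (permuted x σ - permuted x (σ * Equiv.swap i j)) =
      (permuted x σ i - permuted x σ j) * (v i - v j) := by
  rw [permuted_sub_permuted_mul_swap, inner_smul_right, inner_sub_right,
    EuclideanSpace.inner_single_right, EuclideanSpace.inner_single_right]
  simp

theorem norm_permuted_sub_le {x : EuclideanSpace ℝ (Fin n)} (hx : x ∈ unitCube n)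
    (σ : Equiv.Perm (Fin n)) (i j : Fin n) :
    ‖permuted x σ - permuted x (σ * Equiv.swap i j)‖ ≤ 2 := by
  rw [permuted_sub_permuted_mul_swap, norm_smul, Real.norm_eq_abs]
  have h1 := abs_sub_le_one_of_mem_unitCube (permuted_mem_unitCube hx σ)
    (permuted_mem_unitCube hx σ) i j
  have h2 : ‖(EuclideanSpace.single i (1 : ℝ) - EuclideanSpace.single j (1 : ℝ) :
      EuclideanSpace ℝ (Fin n))‖ ≤ 2 := by
    refine (norm_sub_le _ _).trans ?_
    simp only [PiLp.norm_single, norm_one]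
    norm_num
  calc _ ≤ 1 * (2 : ℝ) := mul_le_mul h1 h2 (norm_nonneg _) zero_le_one
    _ = 2 := one_mul _

theorem sum_sum_sub_sq_le (v : EuclideanSpace ℝ (Fin n)) :
    ∑ i, ∑ j, (v i - v j) ^ 2 ≤ 2 * n * ‖v‖ ^ 2 := by
  rw [EuclideanSpace.real_norm_sq_eq]
  have h : ∑ i, ∑ j, (v i - v j) ^ 2 = 2 * n * ∑ i, v i ^ 2 - 2 * (∑ i, v i) ^ 2 := by
    simp only [sub_sq, Finset.sum_add_distrib, Finset.sum_sub_distrib, Finset.sum_const,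
      Finset.card_univ, Fintype.card_fin, nsmul_eq_mul, ← Finset.mul_sum, mul_assoc,
      ← Finset.sum_mul]
    ring
  rw [h]
  linarith [sq_nonneg (∑ i, v i)]

/-- The exponential moment of the squared distance to a convex subset of the cube is at most the
inverse of the probability of that subset. -/
theorem exists_sq_dist_exp_moment_le {x : EuclideanSpace ℝ (Fin n)} (hx : x ∈ unitCube n)
    {K : Set (EuclideanSpace ℝ (Fin n))} (hK : K ⊆ unitCube n) (hne : K.Nonempty)
    (hcl : IsClosed K) (hconv : Convex ℝ K) :
    ∃ p : EuclideanSpace ℝ (Fin n) → EuclideanSpace ℝ (Fin n), (∀ y, p y ∈ K) ∧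
      ∀ A : Equiv.Perm (Fin n) → Prop, ∀ [DecidablePred A], (∀ σ, A σ → permuted x σ ∈ K) →
        permAvg (fun σ => if A σ then (1 : ℝ) else 0) *
          permAvg (fun σ => Real.exp (1 / 52 * ‖permuted x σ - p (permuted x σ)‖ ^ 2)) ≤ 1 := by
  have hproj : ∀ y, ∃ q ∈ K, ∀ w ∈ K, inner ℝ (y - q) (w - q) ≤ 0 := by
    intro y
    obtain ⟨q, hq, h⟩ := exists_norm_eq_iInf_of_complete_convex hne hcl.isComplete hconv y
    exact ⟨q, hq, (norm_eq_iInf_iff_real_inner_le_zero hconv hq).1 h⟩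
  choose p hpK hp using hproj
  refine ⟨p, hpK, fun A _ hA => ?_⟩
  set F : Equiv.Perm (Fin n) → ℝ := fun σ => ‖permuted x σ - p (permuted x σ)‖ ^ 2 with hF
  have hF0 : ∀ σ, 0 ≤ F σ := fun σ => sq_nonneg _
  -- Convexity of the squared distance, whose gradient at `y` is `2(y - p y)`, derived from the
  -- obtuse-angle property of the projection.
  have hgrad : ∀ σ τ, F σ - F τ ≤
      inner ℝ ((2 : ℝ) • (permuted x σ - p (permuted x σ))) (permuted x σ - permuted x τ) := by
    intro σ τ
    set y := permuted x σ
    set z := permuted x τ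
    have h1 := hp y (p z) (hpK z)
    have h2 : 0 ≤ ‖(z - p z) - (y - p y)‖ ^ 2 := sq_nonneg _
    rw [norm_sub_sq_real] at h2
    have h3 : inner ℝ (z - p z) (y - p y) =
        inner ℝ (y - p y) (y - p y) - inner ℝ (y - p y) (y - z) -
          inner ℝ (y - p y) (p z - p y) := by
      rw [real_inner_comm, ← inner_sub_right, ← inner_sub_right]
      congr 1
      abel
    rw [real_inner_self_eq_norm_sq] at h3
    rw [inner_smul_left]
    simp only [hF, RCLike.conj_to_real]
    linarith
  have hdiff : ∀ σ i j, F σ - F (σ * Equiv.swap i j) ≤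
      2 * |(permuted x σ - p (permuted x σ)) i - (permuted x σ - p (permuted x σ)) j| := by
    intro σ i j
    refine (hgrad σ _).trans ?_
    rw [inner_permuted_sub]
    have h1 := abs_sub_le_one_of_mem_unitCube (permuted_mem_unitCube hx σ)
      (permuted_mem_unitCube hx σ) i j
    refine (le_abs_self _).trans ?_
    simp only [PiLp.smul_apply, smul_eq_mul]
    rw [← mul_sub, abs_mul, abs_mul, abs_two]
    exact mul_le_of_le_one_left (by positivity) h1
  have hB : ∀ σ i j, F σ - F (σ * Equiv.swap i j) ≤ 4 := by
    intro σ i j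
    refine (hdiff σ i j).trans ?_
    have h1 := abs_sub_le_one_of_mem_unitCube (permuted_mem_unitCube hx σ)
      (hK (hpK (permuted x σ))) i i
    have h2 := abs_sub_le_one_of_mem_unitCube (permuted_mem_unitCube hx σ)
      (hK (hpK (permuted x σ))) j j
    have h3 := abs_sub ((permuted x σ - p (permuted x σ)) i) ((permuted x σ - p (permuted x σ)) j)
    simp only [PiLp.sub_apply] at h3 ⊢
    linarith
  -- Self-bounding: `8 = 4 · 2`, from the squared gradient factor and from `sum_sum_sub_sq_le`.
  have hV : ∀ σ, ∑ i, ∑ j, (max (F σ - F (σ * Equiv.swap i j)) 0) ^ 2 ≤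
      Fintype.card (Fin n) * (8 * F σ) := by
    intro σ
    have h := sum_sum_sub_sq_le (permuted x σ - p (permuted x σ))
    calc _ ≤ ∑ i, ∑ j, 4 * ((permuted x σ - p (permuted x σ)) i -
          (permuted x σ - p (permuted x σ)) j) ^ 2 := by
          refine Finset.sum_le_sum fun i _ => Finset.sum_le_sum fun j _ => ?_
          rw [← sq_abs ((permuted x σ - p (permuted x σ)) i - _), show (4 : ℝ) = 2 ^ 2 by norm_num,
            ← mul_pow]
          exact pow_le_pow_left₀ (le_max_right _ _)
            (max_le (hdiff σ i j) (by positivity)) 2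
      _ ≤ _ := by
          simp only [← Finset.mul_sum, Fintype.card_fin, hF]
          linarith
  have hV0 : ∀ σ, 0 ≤ 8 * F σ := fun σ => by linarith [hF0 σ]
  -- The constant `24 = 8 · 3` is forced by the lower side, where `exp (4u) ≤ e ≤ 3` for `u ≤ 1/4`.
  -- The scale `1/52` is chosen so that `52 - 24 = 4 + 24`: the two log-Laplace bounds then carry
  -- the same factor and the means of `F` cancel on adding.
  have hup := log_permAvg_exp_le F (a := 0) (b := 24) (l := 1 / 52) (by norm_num) (by
    intro u hu _
    refine (entropy_exp_mul_le hV0 hV hu).trans ?_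
    refine mul_le_mul_of_nonneg_left ?_ (sq_nonneg u)
    rw [zero_mul, zero_add, ← permAvg_const_mul]
    refine permAvg_mono fun σ => ?_
    have := mul_nonneg (hF0 σ) (Real.exp_pos (u * F σ)).le
    linarith)
  have hdown := log_permAvg_exp_le (fun σ => -F σ) (a := 0) (b := -24) (l := 1 / 4) (by norm_num)
    (by
    intro u hu hu4
    refine (entropy_exp_neg_mul_le hV0 hV hB hu).trans ?_
    refine mul_le_mul_of_nonneg_left ?_ (sq_nonneg u)
    rw [zero_mul, zero_add, ← permAvg_const_mul, ← permAvg_const_mul]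
    refine permAvg_mono fun σ => ?_
    have h1 := mul_nonneg (hF0 σ) (Real.exp_pos (u * -F σ)).le
    have h2 : Real.exp (u * 4) ≤ 3 :=
      (Real.exp_le_exp.2 (by linarith : u * 4 ≤ 1)).trans
        (Real.exp_one_lt_d9.le.trans (by norm_num))
    have := mul_le_mul_of_nonneg_right h2 (mul_nonneg (by norm_num : (0 : ℝ) ≤ 8) h1)
    linarith)
  rw [permAvg_neg] at hdown
  have hPA : permAvg (fun σ => if A σ then (1 : ℝ) else 0) ≤
      permAvg fun σ => Real.exp (1 / 4 * -F σ) := by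
    refine permAvg_mono fun σ => ?_
    split_ifs with h
    · have h1 := hp (permuted x σ) (permuted x σ) (hA σ h)
      rw [real_inner_self_eq_norm_sq] at h1
      have : F σ = 0 := le_antisymm h1 (hF0 σ)
      simp [this]
    · exact (Real.exp_pos _).le
  have hpos1 : 0 < permAvg fun σ => Real.exp (1 / 4 * -F σ) := permAvg_pos fun σ => Real.exp_pos _
  have hpos2 : 0 < permAvg fun σ => Real.exp (1 / 52 * F σ) := permAvg_pos fun σ => Real.exp_pos _
  refine (mul_le_mul_of_nonneg_right hPA hpos2.le).trans ?_
  rw [← Real.log_nonpos_iff (by positivity), Real.log_mul hpos1.ne' hpos2.ne']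
  linarith

end ConvexDistance

/-! ### Convex Lipschitz functions: one-sided increments and tails. -/

section ConvexLipschitz

variable {n : ℕ}

/-- A duality argument in place of a subgradient. Jensen and the Lipschitz bound at the average of
the neighbours `z q`, weighted by the decreases `d q`, give `T ≤ L‖w‖`. Cauchy–Schwarz applied to
`⟨w, w⟩` gives `‖w‖² ≤ 2nT`. Together `T² ≤ 2nL²T`. -/
theorem sum_sum_sq_sub_permuted_le {x : EuclideanSpace ℝ (Fin n)} (hx : x ∈ unitCube n)
    {φ : EuclideanSpace ℝ (Fin n) → ℝ} {L : ℝ≥0} (hφ : ConvexOn ℝ (unitCube n) φ)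
    (hL : LipschitzOnWith L φ (unitCube n)) (σ : Equiv.Perm (Fin n)) :
    ∑ i, ∑ j, (max (φ (permuted x σ) - φ (permuted x (σ * Equiv.swap i j))) 0) ^ 2 ≤
      n * (2 * (L : ℝ) ^ 2) := by
  set y := permuted x σ with hy
  set z : Fin n × Fin n → EuclideanSpace ℝ (Fin n) :=
    fun q => permuted x (σ * Equiv.swap q.1 q.2) with hz
  set d : Fin n × Fin n → ℝ := fun q => max (φ y - φ (z q)) 0 with hd
  have hd0 : ∀ q, 0 ≤ d q := fun q => le_max_right _ _
  have hyc : y ∈ unitCube n := permuted_mem_unitCube hx σ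
  have hzc : ∀ q, z q ∈ unitCube n := fun q => permuted_mem_unitCube hx _
  rw [← Fintype.sum_prod_type' (fun i j =>
    (max (φ y - φ (permuted x (σ * Equiv.swap i j))) 0) ^ 2)]
  change ∑ q, d q ^ 2 ≤ _
  set T := ∑ q, d q ^ 2 with hT
  have hT0 : 0 ≤ T := Finset.sum_nonneg fun q _ => sq_nonneg _
  set s := ∑ q, d q with hs
  set w := ∑ q, d q • (y - z q) with hw
  have hs0 : 0 ≤ s := Finset.sum_nonneg fun q _ => hd0 q
  have hTw : T ≤ L * ‖w‖ := by
    rcases hs0.eq_or_lt with h0 | hspos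
    · have hall : ∀ q, d q = 0 := fun q =>
        (Finset.sum_eq_zero_iff_of_nonneg fun q _ => hd0 q).1 h0.symm q (Finset.mem_univ q)
      have : T = 0 := by simp [hT, hall]
      rw [this]
      positivity
    · have hp0 : ∀ q ∈ (Finset.univ : Finset (Fin n × Fin n)), 0 ≤ d q / s := fun q _ =>
        div_nonneg (hd0 q) hs0
      have hp1 : ∑ q, d q / s = 1 := by rw [← Finset.sum_div]; exact div_self hspos.ne'
      have hJ := hφ.map_sum_le hp0 hp1 fun q _ => hzc q
      have hmem := convex_unitCube.sum_mem hp0 hp1 fun q _ => hzc q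
      set m := ∑ q, (d q / s) • z q with hm
      have hterm : ∀ q, (d q / s) • φ (z q) = d q / s * φ y - d q ^ 2 / s := by
        intro q
        have : d q * φ (z q) = d q * φ y - d q ^ 2 := by
          rcases le_total (φ y - φ (z q)) 0 with h | h
          · have : d q = 0 := max_eq_right h
            rw [this]; ring
          · have : d q = φ y - φ (z q) := max_eq_left h
            rw [this]; ring
        rw [smul_eq_mul, div_mul_eq_mul_div, this]
        ring
      rw [Finset.sum_congr rfl fun q _ => hterm q, Finset.sum_sub_distrib, ← Finset.sum_mul, hp1,
        one_mul, ← Finset.sum_div] at hJ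
      have hlip := hL.dist_le_mul y hyc m hmem
      rw [Real.dist_eq, dist_eq_norm] at hlip
      have hyw : y - m = s⁻¹ • w := by
        rw [hw, Finset.smul_sum, hm]
        simp only [smul_sub, smul_smul, Finset.sum_sub_distrib, ← Finset.sum_smul]
        have e : ∀ q, s⁻¹ * d q = d q / s := fun q => by ring
        simp only [e, hp1, one_smul]
      rw [hyw, norm_smul, Real.norm_eq_abs, abs_of_pos (inv_pos.2 hspos)] at hlip
      have h1 : T / s ≤ L * (s⁻¹ * ‖w‖) := by linarith [le_abs_self (φ y - φ m)]
      have h2 := mul_le_mul_of_nonneg_left h1 hs0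
      have h3 : s * (T / s) = T := by field_simp
      have h4 : s * (L * (s⁻¹ * ‖w‖)) = L * ‖w‖ := by field_simp
      rwa [h3, h4] at h2
  have hwT : ‖w‖ ^ 2 ≤ T * (2 * n) := by
    have h1 : ‖w‖ ^ 2 ≤ ∑ q : Fin n × Fin n, d q * |w q.1 - w q.2| := by
      rw [← real_inner_self_eq_norm_sq]
      nth_rw 2 [hw]
      rw [inner_sum]
      refine Finset.sum_le_sum fun q _ => ?_
      rw [inner_smul_right, hy, hz, inner_permuted_sub]
      refine mul_le_mul_of_nonneg_left ((le_abs_self _).trans ?_) (hd0 q)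
      rw [abs_mul]
      exact mul_le_of_le_one_left (abs_nonneg _)
        (abs_sub_le_one_of_mem_unitCube hyc hyc _ _)
    have h2 := Finset.sum_mul_sq_le_sq_mul_sq Finset.univ d
      (fun q : Fin n × Fin n => |w q.1 - w q.2|)
    have h3 : ∑ q : Fin n × Fin n, |w q.1 - w q.2| ^ 2 ≤ 2 * n * ‖w‖ ^ 2 := by
      simp only [sq_abs]
      rw [Fintype.sum_prod_type]
      exact sum_sum_sub_sq_le w
    have h4 : (‖w‖ ^ 2) ^ 2 ≤ T * (2 * n * ‖w‖ ^ 2) :=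
      (pow_le_pow_left₀ (sq_nonneg _) h1 2).trans
        (h2.trans (mul_le_mul_of_nonneg_left h3 hT0))
    rcases (sq_nonneg ‖w‖).eq_or_lt with h0 | hpos
    · rw [← h0]; positivity
    · refine le_of_mul_le_mul_right ?_ hpos
      linarith
  have hTT : T ^ 2 ≤ (L : ℝ) ^ 2 * (T * (2 * n)) := by
    refine (pow_le_pow_left₀ hT0 hTw 2).trans ?_
    rw [mul_pow]
    exact mul_le_mul_of_nonneg_left hwT (sq_nonneg _)
  rcases hT0.eq_or_lt with h0 | hpos
  · rw [← h0]; positivity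
  · refine le_of_mul_le_mul_right ?_ hpos
    linarith

/-! ### Tail probabilities for a uniform permutation. -/

/-- The probability of an event under the uniform law on permutations. -/
noncomputable def permProb (A : Set (Equiv.Perm (Fin n))) : ℝ :=
  permAvg (A.indicator 1)

theorem permProb_le_one (A : Set (Equiv.Perm (Fin n))) : permProb A ≤ 1 := by
  rw [← permAvg_const (α := Fin n) 1]
  refine permAvg_mono fun σ => ?_
  exact Set.indicator_le_self' (fun _ _ => zero_le_one) σ

theorem permProb_nonneg (A : Set (Equiv.Perm (Fin n))) : 0 ≤ permProb A :=
  permAvg_nonneg fun σ => Set.indicator_nonneg (fun _ _ => zero_le_one) σ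

theorem permAvg_add {α : Type*} [Fintype α] [DecidableEq α] (f g : Equiv.Perm α → ℝ) :
    permAvg (fun σ => f σ + g σ) = permAvg f + permAvg g := by
  rw [permAvg, Finset.sum_add_distrib, add_div, permAvg, permAvg]

theorem one_le_permProb_add {A B : Set (Equiv.Perm (Fin n))} (h : ∀ σ, σ ∈ A ∨ σ ∈ B) :
    1 ≤ permProb A + permProb B := by
  rw [permProb, permProb, ← permAvg_add, ← permAvg_const (α := Fin n) 1]
  refine permAvg_mono fun σ => ?_
  have hA := Set.indicator_nonneg (s := A) (f := (1 : Equiv.Perm (Fin n) → ℝ))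
    (fun _ _ => zero_le_one) σ
  have hB := Set.indicator_nonneg (s := B) (f := (1 : Equiv.Perm (Fin n) → ℝ))
    (fun _ _ => zero_le_one) σ
  rcases h σ with h | h
  · rw [Set.indicator_of_mem h]; simpa using hB
  · rw [Set.indicator_of_mem h (f := (1 : Equiv.Perm (Fin n) → ℝ))]; simpa using hA

theorem permProb_le_add {A B C : Set (Equiv.Perm (Fin n))} (h : ∀ σ ∈ A, σ ∈ B ∨ σ ∈ C) :
    permProb A ≤ permProb B + permProb C := by
  rw [permProb, permProb, permProb, ← permAvg_add]
  refine permAvg_mono fun σ => ?_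
  have hB := Set.indicator_nonneg (s := B) (f := (1 : Equiv.Perm (Fin n) → ℝ))
    (fun _ _ => zero_le_one) σ
  have hC := Set.indicator_nonneg (s := C) (f := (1 : Equiv.Perm (Fin n) → ℝ))
    (fun _ _ => zero_le_one) σ
  by_cases hA : σ ∈ A
  · rw [Set.indicator_of_mem hA]
    rcases h σ hA with h | h
    · rw [Set.indicator_of_mem h]; linarith
    · rw [Set.indicator_of_mem h (f := (1 : Equiv.Perm (Fin n) → ℝ))]; linarith
  · rw [Set.indicator_of_notMem hA]; linarith

theorem permProb_mul_exp_le {f : Equiv.Perm (Fin n) → ℝ} {s : ℝ} (A : Set (Equiv.Perm (Fin n)))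
    (h : ∀ σ ∈ A, s ≤ f σ) :
    permProb A * Real.exp s ≤ permAvg fun σ => Real.exp (f σ) := by
  rw [permProb, mul_comm, ← permAvg_const_mul]
  refine permAvg_mono fun σ => ?_
  by_cases hA : σ ∈ A
  · rw [Set.indicator_of_mem hA]
    simpa using h σ hA
  · rw [Set.indicator_of_notMem hA, mul_zero]
    exact (Real.exp_pos _).le

/-- A sublevel set and a superlevel set of a convex Lipschitz function cannot both be likely. -/
theorem permProb_le_mul_permProb_ge_le {x : EuclideanSpace ℝ (Fin n)} (hx : x ∈ unitCube n)
    {φ : EuclideanSpace ℝ (Fin n) → ℝ} {L : ℝ≥0} (hL0 : 0 < L)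
    (hφ : ConvexOn ℝ (unitCube n) φ) (hL : LipschitzOnWith L φ (unitCube n)) {a b : ℝ}
    (hab : a ≤ b) :
    permProb {σ | φ (permuted x σ) ≤ a} * permProb {σ | b ≤ φ (permuted x σ)} ≤
      Real.exp (-((b - a) ^ 2 / (52 * (L : ℝ) ^ 2))) := by
  classical
  set K := {y ∈ unitCube n | φ y ≤ a} with hKdef
  have hLpos : (0 : ℝ) < L := hL0
  by_cases hne : K.Nonempty
  · have hcl : IsClosed K := hL.continuousOn.preimage_isClosed_of_isClosed isClosed_unitCube
      isClosed_Iic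
    obtain ⟨p, hpK, hp⟩ := exists_sq_dist_exp_moment_le hx (fun y hy => hy.1) hne hcl
      (hφ.convex_le a)
    have h1 := hp (fun σ => φ (permuted x σ) ≤ a) fun σ h => ⟨permuted_mem_unitCube hx σ, h⟩
    have h2 : permProb {σ | b ≤ φ (permuted x σ)} * Real.exp ((b - a) ^ 2 / (52 * (L : ℝ) ^ 2)) ≤
        permAvg (fun σ => Real.exp (1 / 52 * ‖permuted x σ - p (permuted x σ)‖ ^ 2)) := by
      refine permProb_mul_exp_le _ fun σ hσ => ?_
      have hlip := hL.dist_le_mul _ (permuted_mem_unitCube hx σ) _ (hpK (permuted x σ)).1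
      rw [Real.dist_eq, dist_eq_norm] at hlip
      have h3 := (hpK (permuted x σ)).2
      have h4 : b ≤ φ (permuted x σ) := hσ
      have h5 : b - a ≤ L * ‖permuted x σ - p (permuted x σ)‖ := by
        linarith [le_abs_self (φ (permuted x σ) - φ (p (permuted x σ)))]
      have h6 := pow_le_pow_left₀ (sub_nonneg.2 hab) h5 2
      rw [div_le_iff₀ (by positivity)]
      linarith
    have h7 : permProb {σ | φ (permuted x σ) ≤ a} =
        permAvg fun σ => if φ (permuted x σ) ≤ a then (1 : ℝ) else 0 := by
      unfold permProb
      congr 1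
    rw [Real.exp_neg, ← one_div, le_div_iff₀ (Real.exp_pos _), mul_assoc, h7]
    refine le_trans (mul_le_mul_of_nonneg_left h2 ?_) h1
    rw [← h7]
    exact permProb_nonneg _
  -- With `K` empty there is nothing to project onto, but the sublevel event is then empty too.
  · have : permProb {σ | φ (permuted x σ) ≤ a} = 0 := by
      have he : {σ | φ (permuted x σ) ≤ a} = (∅ : Set (Equiv.Perm (Fin n))) := by
        ext σ
        refine ⟨fun h => hne ⟨_, permuted_mem_unitCube hx σ, h⟩, fun h => h.elim⟩
      rw [he, permProb, Set.indicator_empty]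
      exact permAvg_const 0
    rw [this, zero_mul]
    exact (Real.exp_pos _).le

/-- An entropy bound up to scale `1 / (2 * L)` controls the probability of exceeding the mean by
`5 * L`. -/
theorem permProb_ge_avg_add_le_half {f : Equiv.Perm (Fin n) → ℝ} {L : ℝ} (hL : 0 < L)
    (h : ∀ u, 0 < u → u ≤ 1 / (2 * L) →
      permAvg (fun σ => u * f σ * Real.exp (u * f σ)) -
        permAvg (fun σ => Real.exp (u * f σ)) * Real.log (permAvg fun σ => Real.exp (u * f σ)) ≤
      u ^ 2 * (6 * L ^ 2 * permAvg (fun σ => Real.exp (u * f σ)))) :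
    permProb {σ | permAvg f + 5 * L ≤ f σ} ≤ 1 / 2 := by
  have h1 := log_permAvg_exp_le f (a := 6 * L ^ 2) (b := 0) (l := 1 / (2 * L)) (by positivity)
    (by simpa only [zero_mul, add_zero] using h)
  set M := permAvg fun σ => Real.exp (1 / (2 * L) * f σ) with hM
  have hMpos : 0 < M := permAvg_pos fun σ => Real.exp_pos _
  have h2 : Real.log M ≤ 1 / (2 * L) * permAvg f + 3 / 2 := by
    have e1 : Real.log M * (1 / (1 / (2 * L)) - 0) = 2 * L * Real.log M := by
      rw [one_div_one_div]; ring
    have e2 : 6 * L ^ 2 * (1 / (2 * L)) = 2 * L * (3 / 2) := by field_simp; norm_num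
    have e3 : permAvg f = 2 * L * (1 / (2 * L) * permAvg f) := by field_simp
    rw [e1, e2] at h1
    refine le_of_mul_le_mul_left (a := 2 * L) ?_ (by positivity)
    linarith
  have h3 := permProb_mul_exp_le (f := fun σ => 1 / (2 * L) * f σ)
    (s := 1 / (2 * L) * permAvg f + 5 / 2) {σ | permAvg f + 5 * L ≤ f σ} (by
      intro σ hσ
      have := mul_le_mul_of_nonneg_left (show permAvg f + 5 * L ≤ f σ from hσ)
        (show 0 ≤ 1 / (2 * L) by positivity)
      have e : 1 / (2 * L) * (5 * L) = 5 / 2 := by field_simp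
      linarith)
  -- Markov at scale `1/(2L)`: the threshold `5L` contributes `5/2` against `3/2` from the Laplace
  -- bound, leaving `exp (-1) < 1/2`.
  have h4 : M ≤ Real.exp (1 / (2 * L) * permAvg f + 5 / 2) * Real.exp (-1) := by
    rw [← Real.exp_add, ← Real.log_le_iff_le_exp hMpos]
    linarith
  have h5 : permProb {σ | permAvg f + 5 * L ≤ f σ} ≤ Real.exp (-1) := by
    refine le_of_mul_le_mul_right ?_ (Real.exp_pos (1 / (2 * L) * permAvg f + 5 / 2))
    rw [mul_comm (Real.exp (-1))]
    exact h3.trans h4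
  exact h5.trans (Real.exp_neg_one_lt_half.le)

/-- These bounds let the mean play the role of a median. The lower tail needs `u ≤ 1/(2L)`: a swap
changes `φ` by at most `2L`, so the factor `exp (u * 2L)` stays below `3`. -/
theorem permProb_tails_le_half {x : EuclideanSpace ℝ (Fin n)} (hx : x ∈ unitCube n)
    {φ : EuclideanSpace ℝ (Fin n) → ℝ} {L : ℝ≥0} (hL0 : 0 < L)
    (hφ : ConvexOn ℝ (unitCube n) φ) (hL : LipschitzOnWith L φ (unitCube n)) :
    permProb {σ | permAvg (fun τ => φ (permuted x τ)) + 5 * L ≤ φ (permuted x σ)} ≤ 1 / 2 ∧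
      permProb {σ | φ (permuted x σ) ≤ permAvg (fun τ => φ (permuted x τ)) - 5 * L} ≤ 1 / 2 := by
  have hLpos : (0 : ℝ) < L := hL0
  have hV0 : ∀ σ : Equiv.Perm (Fin n), 0 ≤ (fun _ => 2 * (L : ℝ) ^ 2) σ := fun _ => by positivity
  have hV : ∀ σ, ∑ i, ∑ j, (max ((fun τ => φ (permuted x τ)) σ -
      (fun τ => φ (permuted x τ)) (σ * Equiv.swap i j)) 0) ^ 2 ≤
      Fintype.card (Fin n) * (fun _ => 2 * (L : ℝ) ^ 2) σ := fun σ => by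
    rw [Fintype.card_fin]
    exact sum_sum_sq_sub_permuted_le hx hφ hL σ
  have hB : ∀ σ i j, (fun τ => φ (permuted x τ)) σ -
      (fun τ => φ (permuted x τ)) (σ * Equiv.swap i j) ≤ 2 * L := by
    intro σ i j
    have hlip := hL.dist_le_mul _ (permuted_mem_unitCube hx σ) _
      (permuted_mem_unitCube hx (σ * Equiv.swap i j))
    rw [Real.dist_eq, dist_eq_norm] at hlip
    have := mul_le_mul_of_nonneg_left (norm_permuted_sub_le hx σ i j) hLpos.le
    have h1 := le_abs_self (φ (permuted x σ) - φ (permuted x (σ * Equiv.swap i j)))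
    simp only
    linarith
  constructor
  · refine permProb_ge_avg_add_le_half hLpos fun u hu _ => ?_
    refine (entropy_exp_mul_le hV0 hV hu).trans ?_
    rw [permAvg_const_mul]
    have : 0 ≤ permAvg fun σ => Real.exp (u * φ (permuted x σ)) :=
      permAvg_nonneg fun σ => (Real.exp_pos _).le
    gcongr
    norm_num
  · have h := permProb_ge_avg_add_le_half (f := fun σ => -φ (permuted x σ)) hLpos
      fun u hu hu2 => by
        refine (entropy_exp_neg_mul_le hV0 hV hB hu).trans ?_
        rw [permAvg_const_mul, ← mul_assoc (Real.exp _)]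
        have h0 : 0 ≤ permAvg fun σ => Real.exp (u * -φ (permuted x σ)) :=
          permAvg_nonneg fun σ => (Real.exp_pos _).le
        have h1 : u * (2 * L) ≤ 1 := (le_div_iff₀ (by positivity)).1 hu2
        have h2 : Real.exp (u * (2 * L)) ≤ 3 :=
          (Real.exp_le_exp.2 h1).trans (Real.exp_one_lt_d9.le.trans (by norm_num))
        refine mul_le_mul_of_nonneg_left (mul_le_mul_of_nonneg_right ?_ h0) (sq_nonneg u)
        have := mul_le_mul_of_nonneg_right h2 (show 0 ≤ 2 * (L : ℝ) ^ 2 by positivity)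
        linarith
    rw [permAvg_neg] at h
    convert h using 3
    ext σ
    constructor <;> intro h' <;> linarith

theorem permProb_abs_sub_ge_le {x : EuclideanSpace ℝ (Fin n)} (hx : x ∈ unitCube n)
    {φ : EuclideanSpace ℝ (Fin n) → ℝ} {L : ℝ≥0} (hL0 : 0 < L)
    (hφ : ConvexOn ℝ (unitCube n) φ) (hL : LipschitzOnWith L φ (unitCube n)) {t : ℝ}
    (ht : 0 < t) :
    permProb {σ | t ≤ |φ (permuted x σ) - permAvg (fun τ => φ (permuted x τ))|} ≤
      2 * Real.exp (-(1 / 1000 * t ^ 2 / (L : ℝ) ^ 2)) := by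
  have hLpos : (0 : ℝ) < L := hL0
  set m := permAvg (fun τ => φ (permuted x τ)) with hm
  set r := t / L with hr
  have hr0 : 0 < r := div_pos ht hLpos
  have htr : t = r * L := by rw [hr]; field_simp
  have hexp : 1 / 1000 * t ^ 2 / (L : ℝ) ^ 2 = r ^ 2 / 1000 := by rw [hr]; ring
  rw [hexp]
  have hlog := Real.log_two_gt_d9
  have hlog' := Real.log_two_lt_d9
  have h2exp : ∀ s : ℝ, 2 * Real.exp s = Real.exp (Real.log 2 + s) := fun s => by
    rw [Real.exp_add, Real.exp_log two_pos]
  -- For `r ≤ 20` the claimed bound is at least `1`, because `400/1000 < log 2`. For `r ≥ 20` the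
  -- exponent `(r-5)²/52` exceeds `r²/1000 + log 2`, which pays for dividing by a probability that
  -- is at least `1/2`.
  rcases le_total r 20 with hr20 | hr20
  · refine (permProb_le_one _).trans ?_
    rw [h2exp, Real.one_le_exp_iff]
    nlinarith
  · obtain ⟨hup, hlow⟩ := permProb_tails_le_half hx hL0 hφ hL
    rw [← hm] at hup hlow
    have hsmall : Real.exp (-((t - 5 * L) ^ 2 / (52 * (L : ℝ) ^ 2))) ≤
        Real.exp (-(r ^ 2 / 1000)) / 2 := by
      have e : (t - 5 * L) ^ 2 / (52 * (L : ℝ) ^ 2) = (r - 5) ^ 2 / 52 := by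
        rw [htr]; field_simp
      rw [le_div_iff₀ two_pos, mul_comm, e, h2exp, Real.exp_le_exp]
      nlinarith
    have hab : ∀ a b c : ℝ, 1 / 2 ≤ a → 0 ≤ b → a * b ≤ c / 2 → b ≤ c := by
      intro a b c h1 h2 h3
      nlinarith
    have hU : permProb {σ | m + t ≤ φ (permuted x σ)} ≤ Real.exp (-(r ^ 2 / 1000)) := by
      refine hab (permProb {σ | φ (permuted x σ) ≤ m + 5 * L}) _ _ ?_ (permProb_nonneg _) ?_
      · have := one_le_permProb_add (A := {σ | φ (permuted x σ) ≤ m + 5 * L})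
          (B := {σ | m + 5 * L ≤ φ (permuted x σ)}) fun σ =>
            le_total (φ (permuted x σ)) _
        linarith
      · refine le_trans ?_ hsmall
        have := permProb_le_mul_permProb_ge_le hx hL0 hφ hL (a := m + 5 * L) (b := m + t)
          (by rw [htr]; nlinarith)
        rwa [add_sub_add_left_eq_sub] at this
    have hD : permProb {σ | φ (permuted x σ) ≤ m - t} ≤ Real.exp (-(r ^ 2 / 1000)) := by
      refine hab (permProb {σ | m - 5 * L ≤ φ (permuted x σ)}) _ _ ?_ (permProb_nonneg _) ?_
      · have := one_le_permProb_add (A := {σ | φ (permuted x σ) ≤ m - 5 * L})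
          (B := {σ | m - 5 * L ≤ φ (permuted x σ)}) fun σ =>
            le_total (φ (permuted x σ)) _
        linarith
      · refine le_trans ?_ hsmall
        have := permProb_le_mul_permProb_ge_le hx hL0 hφ hL (a := m - t) (b := m - 5 * L)
          (by rw [htr]; nlinarith)
        rwa [sub_sub_sub_cancel_left, mul_comm] at this
    have hunion := permProb_le_add
      (A := {σ | t ≤ |φ (permuted x σ) - m|}) (B := {σ | m + t ≤ φ (permuted x σ)})
      (C := {σ | φ (permuted x σ) ≤ m - t}) fun σ hσ => by
        rcases le_abs.1 (show t ≤ |φ (permuted x σ) - m| from hσ) with h | h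
        · left; rw [Set.mem_ofPred_eq]; linarith
        · right; rw [Set.mem_ofPred_eq]; linarith
    linarith

/-! ### Transfer from averages over permutations to the probability space. -/

theorem IsUniformPermutation.measureReal_preimage {Ω : Type*} [MeasurableSpace Ω]
    {P : Measure Ω} [IsProbabilityMeasure P] {π : Ω → Equiv.Perm (Fin n)}
    (hπ : IsUniformPermutation P π) (A : Set (Equiv.Perm (Fin n))) :
    P.real (π ⁻¹' A) = permProb A := by
  classical
  have hset : π ⁻¹' A = ⋃ σ ∈ Finset.univ.filter (· ∈ A), {ω | π ω = σ} := by
    ext ω; simp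
  rw [hset, measureReal_biUnion_finset]
  · simp only [(hπ _).2]
    simp only [permProb, permAvg, Fintype.card_perm, Fintype.card_fin, Set.indicator_apply,
      Pi.one_apply, Finset.sum_div, Finset.sum_filter, ite_div, zero_div]
  · intro σ _ τ _ hne
    refine Set.disjoint_left.2 fun ω h1 h2 => hne ?_
    exact (show π ω = σ from h1).symm.trans h2
  · exact fun σ _ => (hπ σ).1

theorem IsUniformPermutation.integral_comp {Ω : Type*} [MeasurableSpace Ω]
    {P : Measure Ω} [IsProbabilityMeasure P] {π : Ω → Equiv.Perm (Fin n)}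
    (hπ : IsUniformPermutation P π) (f : Equiv.Perm (Fin n) → ℝ) :
    ∫ ω, f (π ω) ∂P = permAvg f := by
  classical
  have hf : ∀ ω, f (π ω) = ∑ σ, {ω | π ω = σ}.indicator (fun _ => f σ) ω := by
    intro ω
    simp [Set.indicator_apply]
  simp only [hf]
  rw [integral_finsetSum]
  · simp only [integral_indicator_const _ (hπ _).1, (hπ _).2]
    simp [permAvg, Fintype.card_perm, div_eq_inv_mul, Finset.mul_sum]
  · exact fun σ _ => (integrable_const _).indicator (hπ σ).1

end ConvexLipschitz

theorem mainTheorem5 :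
    ∃ c : ℝ, 0 < c ∧
      ∀ (n : ℕ) (x : EuclideanSpace ℝ (Fin n)) (φ : EuclideanSpace ℝ (Fin n) → ℝ) (L : ℝ≥0)
        (Ω : Type*) [MeasurableSpace Ω] (P : Measure Ω) [IsProbabilityMeasure P]
        (π : Ω → Equiv.Perm (Fin n)) (Z : Ω → ℝ),
        x ∈ unitCube n →
        0 < L →
        ConvexOn ℝ (unitCube n) φ →
        LipschitzOnWith L φ (unitCube n) →
        IsUniformPermutation P π →
        (∀ ω, Z ω = φ (permuted x (π ω))) →
        ∀ t : ℝ, 0 < t →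
          P.real {ω | t ≤ |Z ω - ∫ ω', Z ω' ∂P|} ≤ 2 * Real.exp (-(c * t ^ 2 / (L : ℝ) ^ 2)) := by
  refine ⟨1 / 1000, by norm_num, ?_⟩
  intro n x φ L Ω _ P _ π Z hx hL0 hφ hL hπ hZ t ht
  have hmean : ∫ ω', Z ω' ∂P = permAvg fun σ => φ (permuted x σ) := by
    simp only [hZ]
    exact hπ.integral_comp fun σ => φ (permuted x σ)
  have hprob := hπ.measureReal_preimage
    {σ | t ≤ |φ (permuted x σ) - permAvg (fun τ => φ (permuted x τ))|}
  rw [hmean]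
  simp only [hZ]
  exact hprob.le.trans (permProb_abs_sub_ge_le hx hL0 hφ hL ht)
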